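/- Let $\mathcal{R}$Ł be the propositional logic whose formulas are built from variables $v_0,v_1,\dots$ with the connectives $\neg$, $\to$ and $\nabla_r$ ($r\in[0,1]$ real). With $\varphi\vee\psi:=(\varphi\to\psi)\to\psi$, $\varphi\wedge\psi:=\neg(\neg\varphi\vee\neg\psi)$ and $\varphi\leftrightarrow\psi:=(\varphi\to\psi)\wedge(\psi\to\varphi)$, its axioms are the Łukasiewicz axioms $\varphi\to(\psi\to\varphi)$; $(\varphi\to\psi)\to((\psi\to\chi)\to(\varphi\to\chi))$; $(\varphi\vee\psi)\to(\psi\vee\varphi)$; $(\neg\psi\to\neg\varphi)\to(\varphi\to\psi)$; together with $\nabla_r(\varphi\to\psi)\leftrightarrow(\nabla_r\varphi\to\nabla_r\psi)$; $\nabla_{\max(r-q,0)}\varphi\leftrightarrow(\nabla_q\varphi\to\nabla_r\varphi)$; $\nabla_r\nabla_q\varphi\leftrightarrow\nabla_{rq}\varphi$; $\nabla_1\varphi\leftrightarrow\varphi$ (for all $r,q\in[0,1]$), and its only rule is modus ponens; $\vdash$ denotes derivability. A formula is rational (a formula of $\mathcal{Q}$Ł) if every $\nabla_r$ occurring in it has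 $r\in\mathbb{Q}$. Put $\Delta_r\varphi:=\neg\nabla_r\neg\varphi$ and $\eta_r:=\Delta_r\eta$, where $\eta$ is a theorem of $\mathcal{R}$Ł (the choice of $\eta$ is immaterial). A sequence $(\varphi_n)_n$ of formulas is increasing if $\vdash\varphi_n\to\varphi_{n+1}$ for all $n$, and decreasing if $\vdash\varphi_{n+1}\to\varphi_n$ for all $n$. A formula $\varphi$ is the limit of $(\varphi_n)_n$, written $\varphi=\lim_n\varphi_n$, if for every $r\in[0,1)$ there is $k$ such that $\vdash\eta_r\to(\varphi\leftrightarrow\varphi_n)$ for all $n\ge k$. **Theorem.** For every formula $\varphi$ of $\mathcal{R}$Ł there exist an increasing sequence $(\alpha_n)_n$ of rational formulas and a decreasing sequence $(\beta_n)_n$ of rational formulas such that $\varphi=\lim_n\alpha_n=\lim_n\beta_n$. -/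

import Mathlib

namespace RL

/-- Formulas of `ℛŁ`: propositional variables `v₀, v₁, …`, negation, implication, and one unary
connective `∇_r` for each real `r ∈ [0,1]`. -/
inductive Formula : Type
  | var : ℕ → Formula
  | neg : Formula → Formula
  | imp : Formula → Formula → Formula
  | nabla : unitInterval → Formula → Formula

namespace Formula

/-- `φ ∨ ψ := (φ → ψ) → ψ`. -/
def or (φ ψ : Formula) : Formula := imp (imp φ ψ) ψ

/-- `φ ∧ ψ := ¬(¬φ ∨ ¬ψ)`. -/
def and (φ ψ : Formula) : Formula := neg (or (neg φ) (neg ψ))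

/-- `φ ↔ ψ := (φ → ψ) ∧ (ψ → φ)`. -/
def iff (φ ψ : Formula) : Formula := and (imp φ ψ) (imp ψ φ)

/-- `Δ_r φ := ¬∇_r ¬φ`. -/
def delta (r : unitInterval) (φ : Formula) : Formula := neg (nabla r (neg φ))

/-- A formula is rational (a formula of `𝒬Ł`) if every `∇_r` occurring in it has `r` rational. -/
def IsRational : Formula → Prop
  | var _ => True
  | neg φ => IsRational φ
  | imp φ ψ => IsRational φ ∧ IsRational ψ
  | nabla r φ => (∃ q : ℚ, (q : ℝ) = (r : ℝ)) ∧ IsRational φ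

end Formula

/-- The Łukasiewicz conjunction of `[0,1]`: `x ⊙ y = max (x + y - 1) 0`. -/
def odot (x y : unitInterval) : unitInterval :=
  ⟨max ((x : ℝ) + (y : ℝ) - 1) 0, le_max_right _ _,
    max_le (by linarith [x.2.2, y.2.2]) zero_le_one⟩

open Formula in
/-- `Provable φ` means `⊢ φ` in `ℛŁ`: `φ` is derivable from the axiom schemes by modus ponens.
In `R2`, `unitInterval.symm q` is `q* = 1 - q`. -/
inductive Provable : Formula → Prop
  | L1 (φ ψ : Formula) : Provable (imp φ (imp ψ φ))
  | L2 (φ ψ χ : Formula) : Provable (imp (imp φ ψ) (imp (imp ψ χ) (imp φ χ)))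
  | L3 (φ ψ : Formula) : Provable (imp (or φ ψ) (or ψ φ))
  | L4 (φ ψ : Formula) : Provable (imp (imp (neg ψ) (neg φ)) (imp φ ψ))
  | R1 (r : unitInterval) (φ ψ : Formula) :
      Provable (iff (nabla r (imp φ ψ)) (imp (nabla r φ) (nabla r ψ)))
  | R2 (r q : unitInterval) (φ : Formula) :
      Provable (iff (nabla (odot r (unitInterval.symm q)) φ) (imp (nabla q φ) (nabla r φ)))
  | R3 (r q : unitInterval) (φ : Formula) :
      Provable (iff (nabla r (nabla q φ)) (nabla (r * q) φ))
  | R4 (φ : Formula) : Provable (iff (nabla 1 φ) φ)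
  | mp {φ ψ : Formula} : Provable φ → Provable (imp φ ψ) → Provable ψ

/-- A sequence of formulas is increasing if `⊢ φₙ → φₙ₊₁` for all `n`. -/
def IsIncreasing (φ : ℕ → Formula) : Prop :=
  ∀ n, Provable (Formula.imp (φ n) (φ (n + 1)))

/-- A sequence of formulas is decreasing if `⊢ φₙ₊₁ → φₙ` for all `n`. -/
def IsDecreasing (φ : ℕ → Formula) : Prop :=
  ∀ n, Provable (Formula.imp (φ (n + 1)) (φ n))

/-- `φ` is the (syntactic) limit of `(φₙ)`: for any `r ∈ [0,1)` there is `k` such that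
`⊢ η_r → (φ ↔ φₙ)` for all `n ≥ k`, where `η_r = Δ_r η` and `η` is a theorem of `ℛŁ`.
The notion does not depend on `η`; the definition demands the condition for every theorem `η`. -/
def IsLimit (φs : ℕ → Formula) (φ : Formula) : Prop :=
  ∀ η : Formula, Provable η → ∀ r : unitInterval, r < 1 → ∃ k : ℕ, ∀ n, k ≤ n →
    Provable (Formula.imp (Formula.delta r η) (Formula.iff φ (φs n)))

end RL

namespace RL

/-! ### Łukasiewicz calculus -/

namespace Provable

open Formula

variable {φ ψ χ θ : Formula} {r q t : unitInterval}

/-! Read `∇_r φ` as `1 - r(1 - φ)`, so `∇_t ¬η` is the constant `1 - t`. Negation and the antecedent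
of an implication reverse order, so the induction on formulas builds lower and upper rational
sequences together (`exists_rational_enclosure`). Convergence then concerns only one implication, up
to a vanishing error (`EventuallyImp`). Errors add under composition, by `nabla_imp_of_half`, and
changing the index of `∇` by `t` costs at most `t`, by `nabla_imp_nabla_imp_nabla`. -/

theorem trans (h₁ : Provable (imp φ ψ)) (h₂ : Provable (imp ψ χ)) : Provable (imp φ χ) :=
  mp h₂ (mp h₁ (L2 φ ψ χ))

/-- Pseudo modus ponens, `⊢ φ → ((φ → ψ) → ψ)`. -/
theorem assertion (φ ψ : Formula) : Provable (imp φ (imp (imp φ ψ) ψ)) :=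
  trans (L1 φ (imp ψ φ)) (L3 ψ φ)

theorem exchange (φ ψ χ : Formula) :
    Provable (imp (imp φ (imp ψ χ)) (imp ψ (imp φ χ))) :=
  trans (L2 φ (imp ψ χ) χ) (mp (assertion ψ χ) (L2 ψ (imp (imp ψ χ) χ) (imp φ χ)))

theorem swap (h : Provable (imp φ (imp ψ χ))) : Provable (imp ψ (imp φ χ)) :=
  mp h (exchange φ ψ χ)

theorem refl (φ : Formula) : Provable (imp φ φ) :=
  mp (L1 φ φ) (swap (L1 φ (imp φ (imp φ φ))))

theorem weaken (φ : Formula) (h : Provable ψ) : Provable (imp φ ψ) :=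
  mp h (L1 ψ φ)

theorem detach (h : Provable (imp φ (imp ψ χ))) (hψ : Provable ψ) : Provable (imp φ χ) :=
  mp hψ (swap h)

theorem prefixing (φ ψ χ : Formula) :
    Provable (imp (imp ψ χ) (imp (imp φ ψ) (imp φ χ))) :=
  swap (L2 φ ψ χ)

theorem neg_neg_elim (φ : Formula) : Provable (imp (neg (neg φ)) φ) :=
  detach (trans (trans (L1 (neg (neg φ)) (neg (neg (imp φ φ)))) (L4 _ _)) (L4 _ _)) (refl φ)

theorem neg_neg_intro (φ : Formula) : Provable (imp φ (neg (neg φ))) :=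
  mp (neg_neg_elim (neg φ)) (L4 _ _)

theorem contrapositive (φ ψ : Formula) :
    Provable (imp (imp φ ψ) (imp (neg ψ) (neg φ))) :=
  trans (trans (mp (neg_neg_elim φ) (L2 _ _ ψ)) (mp (neg_neg_intro ψ) (prefixing _ _ _)))
    (L4 _ _)

theorem contrapose (h : Provable (imp φ ψ)) : Provable (imp (neg ψ) (neg φ)) :=
  mp h (contrapositive φ ψ)

theorem exfalso (hθ : Provable θ) (ψ : Formula) : Provable (imp (neg θ) ψ) :=
  detach (trans (L1 (neg θ) (neg ψ)) (L4 θ ψ)) hθ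

theorem neg_of_imp_neg (hθ : Provable θ) (φ : Formula) :
    Provable (imp (imp φ (neg θ)) (neg φ)) :=
  detach (contrapositive φ (neg θ)) (mp hθ (neg_neg_intro θ))

theorem imp_congr (h₁ : Provable (imp ψ φ)) (h₂ : Provable (imp χ θ)) :
    Provable (imp (imp φ χ) (imp ψ θ)) :=
  trans (mp h₁ (L2 ψ φ χ)) (mp h₂ (prefixing ψ χ θ))

/-- Replacing `φ` by `χ` gives `χ ∨ ψ`, which `L3` turns into `(ψ → χ) → χ`. -/
theorem or_elim (h₁ : Provable (imp φ χ)) (h₂ : Provable (imp ψ χ)) :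
    Provable (imp (or φ ψ) χ) :=
  detach (trans (mp (mp h₁ (L2 φ χ ψ)) (L2 _ _ ψ)) (L3 χ ψ)) h₂

theorem and_left (φ ψ : Formula) : Provable (imp (and φ ψ) φ) :=
  trans (contrapose (assertion (neg φ) (neg ψ))) (neg_neg_elim φ)

theorem and_right (φ ψ : Formula) : Provable (imp (and φ ψ) ψ) :=
  trans (contrapose (L1 (neg ψ) (imp (neg φ) (neg ψ)))) (neg_neg_elim ψ)

theorem and_intro (h₁ : Provable (imp θ φ)) (h₂ : Provable (imp θ ψ)) :
    Provable (imp θ (and φ ψ)) :=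
  trans (neg_neg_intro θ) (contrapose (or_elim (contrapose h₁) (contrapose h₂)))

theorem iff_mp (h : Provable (iff φ ψ)) : Provable (imp φ ψ) :=
  mp h (and_left _ _)

theorem iff_mpr (h : Provable (iff φ ψ)) : Provable (imp ψ φ) :=
  mp h (and_right _ _)

/-! ### The connectives `∇_r` and the constants `∇_t ¬θ` -/

theorem nabla_zero (φ : Formula) : Provable (nabla 0 φ) := by
  have h : odot 1 (unitInterval.symm 1) = 0 := by
    ext; simp [odot]
  exact mp (refl _) (h ▸ iff_mpr (R2 1 1 φ))

/-- When `r ≤ q`, truncated subtraction gives `0`, so `R2` equates the implication with the theorem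
`∇_0 φ`. -/
theorem nabla_antitone (h : r ≤ q) (φ : Formula) :
    Provable (imp (nabla q φ) (nabla r φ)) := by
  have h0 : odot r (unitInterval.symm q) = 0 := by
    ext
    have : (r : ℝ) ≤ q := h
    simp [odot]; linarith
  have := R2 r q φ
  rw [h0] at this
  exact mp (nabla_zero φ) (iff_mp this)

theorem imp_nabla (r : unitInterval) (φ : Formula) : Provable (imp φ (nabla r φ)) :=
  trans (iff_mpr (R4 φ)) (nabla_antitone unitInterval.le_one' φ)

theorem imp_nabla_imp (r : unitInterval) (φ ψ : Formula) :
    Provable (imp (imp φ ψ) (imp (nabla r φ) (nabla r ψ))) :=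
  trans (imp_nabla r _) (iff_mp (R1 r φ ψ))

theorem nabla_mono (r : unitInterval) (h : Provable (imp φ ψ)) :
    Provable (imp (nabla r φ) (nabla r ψ)) :=
  mp h (imp_nabla_imp r φ ψ)

theorem odot_one_left (q : unitInterval) : odot 1 q = q := by
  ext; simp [odot, q.2.1]

/-- `R2` at `r = 1` exhibits `∇_{1-q} ¬θ` as `∇_q ¬θ → ¬θ`, and `¬θ` acts as falsum. -/
theorem nabla_symm_imp_neg (hθ : Provable θ) (q : unitInterval) :
    Provable (imp (nabla (unitInterval.symm q) (neg θ)) (neg (nabla q (neg θ)))) := by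
  have h := R2 1 q (neg θ)
  rw [odot_one_left] at h
  exact trans (trans (iff_mp h) (imp_congr (refl _) (iff_mp (R4 _)))) (neg_of_imp_neg hθ _)

theorem neg_nabla_imp_symm (θ : Formula) (q : unitInterval) :
    Provable (imp (neg (nabla q (neg θ))) (nabla (unitInterval.symm q) (neg θ))) := by
  have h := R2 1 q (neg θ)
  rw [odot_one_left] at h
  exact trans (trans (L1 _ (neg (nabla 1 (neg θ)))) (L4 _ _)) (iff_mpr h)

/-- If the constant `1 - t/2` implies `φ` and implies `ψ`, then `1 - t` implies every consequence
`χ` of the strong conjunction of `φ` and `ψ`. -/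
theorem nabla_imp_of_half (hθ : Provable θ) (hr : 2 * (r : ℝ) = t)
    (h₁ : Provable (imp (nabla r (neg θ)) φ)) (h₂ : Provable (imp (nabla r (neg θ)) ψ))
    (h : Provable (imp φ (imp ψ χ))) : Provable (imp (nabla t (neg θ)) χ) := by
  have hP : Provable (imp (nabla r (neg θ)) (imp (nabla r (neg θ)) χ)) :=
    trans h₁ (trans h (mp h₂ (L2 _ _ _)))
  -- With `c = ∇_r ¬θ`, this is `¬χ → (c → ¬c)`. Since `¬c` is `∇_{1-r} ¬θ`, `R2` makes `c → ¬c` the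
  -- constant `∇_{1-2r} ¬θ`, that is `¬∇_t ¬θ`.
  have hN := swap (trans hP (contrapositive _ χ))
  have hR := R2 (unitInterval.symm r) r (neg θ)
  have ho : odot (unitInterval.symm r) (unitInterval.symm r) = unitInterval.symm t := by
    ext
    have := t.2.2
    simp only [odot, unitInterval.coe_symm_eq]
    rw [max_eq_left] <;> linarith
  rw [ho] at hR
  exact mp (trans (trans (trans hN (imp_congr (refl _) (neg_nabla_imp_symm θ r))) (iff_mpr hR))
    (nabla_symm_imp_neg hθ t)) (L4 _ _)

/-- By `R2` the conclusion is `∇_{max(r-q,0)} φ`, which follows from `∇_t φ`, hence from `∇_t ¬θ`.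
-/
theorem nabla_imp_nabla_imp_nabla (hθ : Provable θ) (h : (r : ℝ) ≤ q + t) (φ : Formula) :
    Provable (imp (nabla t (neg θ)) (imp (nabla q φ) (nabla r φ))) := by
  have ho : odot r (unitInterval.symm q) ≤ t := by
    refine max_le ?_ t.2.1
    rw [unitInterval.coe_symm_eq]; linarith
  exact trans (nabla_mono t (exfalso hθ φ)) (trans (nabla_antitone ho φ) (iff_mp (R2 r q φ)))

end Provable

/-- Every point of `[0,1]` is the limit of an increasing sequence of rational points. -/
theorem exists_rat_seq_monotone (r : unitInterval) :
    ∃ p : ℕ → unitInterval, (∀ n, ∃ x : ℚ, (x : ℝ) = p n) ∧ Monotone p ∧ (∀ n, p n ≤ r) ∧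
      ∀ t : unitInterval, 0 < t → ∃ k, ∀ n, k ≤ n → (r : ℝ) ≤ p n + t := by
  obtain ⟨u, hu, hlt, hlim⟩ := Real.exists_seq_rat_strictMono_tendsto (r : ℝ)
  -- The rationals below `r` may be negative, always so when `r = 0`; hence the truncation at `0`.
  have hle : ∀ n, max (u n : ℝ) 0 ≤ r := fun n => max_le (hlt n).le r.2.1
  refine ⟨fun n => ⟨max (u n : ℝ) 0, le_max_right _ _, (hle n).trans r.2.2⟩,
    fun n => ⟨max (u n) 0, by push_cast; rfl⟩, fun m n hmn => ?_, hle, fun t ht => ?_⟩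
  · exact max_le_max (Rat.cast_le.2 (hu.monotone hmn)) (le_refl (0 : ℝ))
  · have ht' : (r : ℝ) - t < r := sub_lt_self _ ht
    obtain ⟨k, hk⟩ := Filter.eventually_atTop.1 (hlim.eventually (lt_mem_nhds ht'))
    refine ⟨k, fun n hn => ?_⟩
    have h1 := hk n hn
    have h2 := le_max_left (u n : ℝ) 0
    change (r : ℝ) ≤ max (u n : ℝ) 0 + t
    linarith

/-- Every point of `[0,1]` is the limit of a decreasing sequence of rational points. -/
theorem exists_rat_seq_antitone (r : unitInterval) :
    ∃ p : ℕ → unitInterval, (∀ n, ∃ x : ℚ, (x : ℝ) = p n) ∧ Antitone p ∧ (∀ n, r ≤ p n) ∧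
      ∀ t : unitInterval, 0 < t → ∃ k, ∀ n, k ≤ n → (p n : ℝ) ≤ r + t := by
  obtain ⟨p, hrat, hmono, hle, hlim⟩ := exists_rat_seq_monotone (unitInterval.symm r)
  refine ⟨fun n => unitInterval.symm (p n), fun n => ?_, fun m n hmn => ?_, fun n => ?_,
    fun t ht => ?_⟩
  · obtain ⟨x, hx⟩ := hrat n
    exact ⟨1 - x, by simp [hx]⟩
  · exact unitInterval.symm_le_symm.2 (hmono hmn)
  · exact unitInterval.le_symm_comm.1 (hle n)
  · obtain ⟨k, hk⟩ := hlim t ht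
    refine ⟨k, fun n hn => ?_⟩
    have := hk n hn
    rw [unitInterval.coe_symm_eq] at this ⊢
    linarith

/-- `⊢ φₙ → ψₙ` up to an error that tends to zero: for each `t > 0`, eventually the constant
`1 - t` (written `∇_t ¬η` for a theorem `η`) implies `φₙ → ψₙ`. -/
def EventuallyImp (φ ψ : ℕ → Formula) : Prop :=
  ∀ η, Provable η → ∀ t : unitInterval, 0 < t → ∃ k, ∀ n, k ≤ n →
    Provable (Formula.imp (Formula.nabla t (Formula.neg η)) (Formula.imp (φ n) (ψ n)))

/-! ### Calculus of vanishing errors -/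

namespace EventuallyImp

open Provable Formula

theorem of_provable {φ ψ : ℕ → Formula} (h : ∀ n, Provable (imp (φ n) (ψ n))) :
    EventuallyImp φ ψ :=
  fun _ _ _ _ => ⟨0, fun n _ => weaken _ (h n)⟩

theorem map {φ ψ φ' ψ' : ℕ → Formula} (h : EventuallyImp φ ψ)
    (H : ∀ n, Provable (imp (imp (φ n) (ψ n)) (imp (φ' n) (ψ' n)))) : EventuallyImp φ' ψ' :=
  fun η hη t ht => (h η hη t ht).imp fun _ hk n hn => (hk n hn).trans (H n)

theorem map₂ {φ₁ ψ₁ φ₂ ψ₂ φ ψ : ℕ → Formula} (h₁ : EventuallyImp φ₁ ψ₁)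
    (h₂ : EventuallyImp φ₂ ψ₂)
    (H : ∀ n, Provable (imp (imp (φ₁ n) (ψ₁ n)) (imp (imp (φ₂ n) (ψ₂ n)) (imp (φ n) (ψ n))))) :
    EventuallyImp φ ψ := by
  intro η hη t ht
  have ht0 : (0 : ℝ) < t := ht
  have ht1 := t.2.2
  -- Each hypothesis is granted half of the error.
  let s : unitInterval := ⟨t / 2, by linarith, by linarith⟩
  have hs : 0 < s := half_pos ht0
  obtain ⟨k, hk⟩ := h₁ η hη s hs
  obtain ⟨l, hl⟩ := h₂ η hη s hs
  exact ⟨max k l, fun n hn => nabla_imp_of_half hη (mul_div_cancel₀ _ two_ne_zero)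
    (hk n (le_of_max_le_left hn)) (hl n (le_of_max_le_right hn)) (H n)⟩

theorem trans {φ ψ χ : ℕ → Formula} (h₁ : EventuallyImp φ ψ) (h₂ : EventuallyImp ψ χ) :
    EventuallyImp φ χ :=
  h₁.map₂ h₂ fun _ => L2 _ _ _

theorem imp_congr {φ φ' ψ ψ' : ℕ → Formula} (h₁ : EventuallyImp φ' φ)
    (h₂ : EventuallyImp ψ ψ') :
    EventuallyImp (fun n => imp (φ n) (ψ n)) (fun n => imp (φ' n) (ψ' n)) :=
  h₁.map₂ h₂ fun n => (L2 (φ' n) (φ n) (ψ n)).trans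
    (swap ((prefixing (φ' n) (ψ n) (ψ' n)).trans (prefixing (imp (φ n) (ψ n)) _ _)))

/-- The passage goes through `∇_{p n} (ψ n)`: first the formula changes, then the index. -/
theorem nabla {p q : ℕ → unitInterval} {φ ψ : ℕ → Formula} (h : EventuallyImp φ ψ)
    (hpq : ∀ t : unitInterval, 0 < t → ∃ k, ∀ n, k ≤ n → (q n : ℝ) ≤ p n + t) :
    EventuallyImp (fun n => Formula.nabla (p n) (φ n)) (fun n => Formula.nabla (q n) (ψ n)) := by
  refine trans (h.map fun n => imp_nabla_imp (p n) _ _) fun η hη t ht => ?_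
  obtain ⟨k, hk⟩ := hpq t ht
  exact ⟨k, fun n hn => nabla_imp_nabla_imp_nabla hη (hk n hn) _⟩

/-- `η_r` implies the constant `∇_{1-r} ¬η`, so the admissible error is `1 - r > 0`. -/
theorem isLimit {φ : Formula} {α : ℕ → Formula} (h₁ : EventuallyImp (fun _ => φ) α)
    (h₂ : EventuallyImp α fun _ => φ) : IsLimit α φ := by
  intro η hη r hr
  have hs : 0 < unitInterval.symm r := by
    have : (r : ℝ) < 1 := hr
    change (0 : ℝ) < 1 - r
    linarith
  obtain ⟨k, hk⟩ := h₁ η hη _ hs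
  obtain ⟨l, hl⟩ := h₂ η hη _ hs
  exact ⟨max k l, fun n hn => (neg_nabla_imp_symm η r).trans
    (and_intro (hk n (le_of_max_le_left hn)) (hl n (le_of_max_le_right hn)))⟩

end EventuallyImp

open Provable in
/-- Every formula is enclosed between an increasing and a decreasing sequence of rational formulas,
up to errors that tend to zero. -/
theorem exists_rational_enclosure (φ : Formula) :
    ∃ α β : ℕ → Formula,
      ((∀ n, (α n).IsRational) ∧ IsIncreasing α ∧ (∀ n, Provable (.imp (α n) φ)) ∧
        EventuallyImp (fun _ => φ) α) ∧
      ((∀ n, (β n).IsRational) ∧ IsDecreasing β ∧ (∀ n, Provable (.imp φ (β n))) ∧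
        EventuallyImp β fun _ => φ) := by
  induction φ with
  | var i =>
    have h : ∀ _ : ℕ, Provable (.imp (.var i) (.var i)) := fun _ => refl _
    exact ⟨fun _ => .var i, fun _ => .var i,
      ⟨fun _ => trivial, h, h, .of_provable h⟩, ⟨fun _ => trivial, h, h, .of_provable h⟩⟩
  | neg φ ih =>
    obtain ⟨α, β, ⟨hα, iα, lα, cα⟩, ⟨hβ, dβ, uβ, cβ⟩⟩ := ih
    exact ⟨fun n => .neg (β n), fun n => .neg (α n),
      ⟨hβ, fun n => contrapose (dβ n), fun n => contrapose (uβ n),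
        cβ.map fun n => contrapositive _ _⟩,
      ⟨hα, fun n => contrapose (iα n), fun n => contrapose (lα n),
        cα.map fun n => contrapositive _ _⟩⟩
  | imp φ ψ ih₁ ih₂ =>
    obtain ⟨α, β, ⟨hα, iα, lα, cα⟩, ⟨hβ, dβ, uβ, cβ⟩⟩ := ih₁
    obtain ⟨α', β', ⟨hα', iα', lα', cα'⟩, ⟨hβ', dβ', uβ', cβ'⟩⟩ := ih₂
    exact ⟨fun n => .imp (β n) (α' n), fun n => .imp (α n) (β' n),
      ⟨fun n => ⟨hβ n, hα' n⟩, fun n => imp_congr (dβ n) (iα' n),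
        fun n => imp_congr (uβ n) (lα' n), cβ.imp_congr cα'⟩,
      ⟨fun n => ⟨hα n, hβ' n⟩, fun n => imp_congr (iα n) (dβ' n),
        fun n => imp_congr (lα n) (uβ' n), cα.imp_congr cβ'⟩⟩
  | nabla r φ ih =>
    obtain ⟨α, β, ⟨hα, iα, lα, cα⟩, ⟨hβ, dβ, uβ, cβ⟩⟩ := ih
    obtain ⟨p, hp, mp, lp, cp⟩ := exists_rat_seq_monotone r
    obtain ⟨q, hq, aq, uq, cq⟩ := exists_rat_seq_antitone r
    -- `∇` is antitone in its index, so the lower sequence takes indices decreasing to `r`.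
    exact ⟨fun n => .nabla (q n) (α n), fun n => .nabla (p n) (β n),
      ⟨fun n => ⟨hq n, hα n⟩,
        fun n => (nabla_mono _ (iα n)).trans (nabla_antitone (aq n.le_succ) _),
        fun n => (nabla_mono _ (lα n)).trans (nabla_antitone (uq n) _), cα.nabla cq⟩,
      ⟨fun n => ⟨hp n, hβ n⟩,
        fun n => (nabla_mono _ (dβ n)).trans (nabla_antitone (mp n.le_succ) _),
        fun n => (nabla_mono _ (uβ n)).trans (nabla_antitone (lp n) _), cβ.nabla cp⟩⟩

end RL

theorem mainTheorem2 (φ : RL.Formula) :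
    ∃ α β : ℕ → RL.Formula,
      (∀ n, (α n).IsRational) ∧ RL.IsIncreasing α ∧ RL.IsLimit α φ ∧
      (∀ n, (β n).IsRational) ∧ RL.IsDecreasing β ∧ RL.IsLimit β φ := by
  obtain ⟨α, β, ⟨hα, iα, lα, cα⟩, ⟨hβ, dβ, uβ, cβ⟩⟩ := RL.exists_rational_enclosure φ
  exact ⟨α, β, hα, iα, cα.isLimit (.of_provable lα), hβ, dβ,
    RL.EventuallyImp.isLimit (.of_provable uβ) cβ⟩
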